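/- Let $P$ be a poset, viewed as a category with a unique morphism $x\to y$ if and only if $x\le y$, and let $\mathbb F$ be a field. Let $\operatorname{Rep}(P,\mathbb F)$ be the category of contravariant $\mathbb F$-linear representations of $P$, that is, of functors from $P^{\mathrm{op}}$ to $\mathbb F$-vector spaces. For $x\in P$ let $h_x$ denote the representable functor, so $h_x(y)=\mathbb F$ if $y\le x$ and $h_x(y)=0$ otherwise (with identity structure maps $h_x(y)\to h_x(y')$ for $y'\le y\le x$). Let $\operatorname{rep}(P,\mathbb F)$ be the full subcategory of finitely presented representations, that is, of cokernels of morphisms $\bigoplus_{i=1}^m h_{a_i}\to\bigoplus_{j=1}^n h_{b_j}$ between finite direct sums of representable functors. Write ${\downarrow} x=\{y\in P\mid y\le x\}$, and call a subset of a poset an ideal if it is downward closed. Then the following holds. 1. The category $\operatorname{rep}(P,\mathbb F)$ is abelian and all its objects are of finite length (i.e. have a finite composition series) if and only if for each $x\in P$ the set ${\downarrow} x$ is finite. 2. The category $\operatorname{rep}(P,\mathbb F)$ is abelian and all its objects are noetherian (i.e. satisfy the ascending chain condition on subobjects in $\operatorname{rep}(P,\mathbb F)$) if and only if for each $x\in P$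 every ascending chain $I_0\subseteq I_1\subseteq\cdots$ of ideals of ${\downarrow} x$ stabilises. -/

import Mathlib

open CategoryTheory CategoryTheory.Limits Opposite

universe u v

noncomputable section

namespace PosetRep

/-- The category `Rep(P, F)` of all contravariant `F`-linear representations of a poset `P`:
functors from `Pᵒᵖ` to `F`-vector spaces, where `P` is viewed as a category with a unique
morphism `x ⟶ y` precisely when `x ≤ y`. -/
abbrev Rep (P : Type u) [PartialOrder P] (F : Type v) [Field F] : Type _ :=
  Pᵒᵖ ⥤ ModuleCat.{max u v} F

/-- The representable functor `h_x`: it sends `y` to the free `F`-module on the set of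
morphisms `y ⟶ x` of `P`, so to a copy of `F` if `y ≤ x`, and to zero otherwise. -/
def representable {P : Type u} [PartialOrder P] (F : Type v) [Field F] (x : P) : Rep P F where
  obj := fun y => ModuleCat.of F ((y.unop ⟶ x) →₀ F)
  map := fun f => ModuleCat.ofHom (Finsupp.lmapDomain F F fun g => f.unop ≫ g)
  map_id := fun y => by
    ext g : 3
    simp
  map_comp := fun f f' => by
    ext g : 3
    simp

/-- A representation is finitely presented if it is the cokernel of a morphism between finite
direct sums of representable functors. -/
def IsFinitelyPresented (P : Type u) [PartialOrder P] (F : Type v) [Field F] :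
    ObjectProperty (Rep P F) :=
  fun M => ∃ (m n : ℕ) (a : Fin m → P) (b : Fin n → P)
    (f : (∐ fun i => representable F (a i)) ⟶ ∐ fun j => representable F (b j)),
    Nonempty (M ≅ cokernel f)

/-- The category `rep(P, F)`: the full subcategory of `Rep(P, F)` whose objects are the finitely
presented representations. -/
abbrev FpRep (P : Type u) [PartialOrder P] (F : Type v) [Field F] : Type _ :=
  (IsFinitelyPresented P F).FullSubcategory

/-- An object of an abelian category has finite length if it has a finite composition series
`0 = X₀ ⊆ X₁ ⊆ ⋯ ⊆ Xₙ` with every factor `Xᵢ₊₁ / Xᵢ` simple. -/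
inductive HasFiniteLength {C : Type u} [Category.{v} C] [Abelian C] : C → Prop
  | of_isZero {X : C} (hX : IsZero X) : HasFiniteLength X
  | of_simple_cokernel {X Y : C} (f : X ⟶ Y) (hf : Mono f) (hs : Simple (cokernel f))
      (hX : HasFiniteLength X) : HasFiniteLength Y

end PosetRep

end

/-! Since `P` is a poset, maps `h_y ⟶ h_x` are scalar multiples of one canonical map, so a subobject
of `h_x` in `Rep` is determined by the ideal of those `y ≤ x` whose canonical map factors through
it. Chain conditions on ideals thus pass to `h_x` (`strictMono_lowerSetOfSubobject`). If every `h_x`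
is noetherian, finitely presented means noetherian in `Rep`; such objects are closed under
subobjects, quotients and extensions, so `rep` is abelian with the kernels of `Rep`. If every `↓x`
is finite, `h_x` is also artinian, and finite length follows.

For the converses nothing is known about kernels in `rep`, but cokernels formed in `Rep` always stay
in `rep`. Hence epimorphisms of `rep` are pointwise surjective, a simple object is supported on at
most one point, and finite length forces finite support; the support of `h_x` is `↓x`. A strictly
ascending chain of ideals gives points `y n ≤ x` with `y n` below no earlier `y i`, and the kernels
of the quotients of `h_x` by ever more `h_{y i}` increase strictly. -/

noncomputable section

namespace PosetRep

/-! ### Chain conditions and finite length in abelian categories. -/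

section AbelianCategory

variable {C : Type u} [Category.{v} C] [Abelian C]

theorem factors_iff_comp_cokernel_eq_zero {X Y : C} (S : Subobject Y) (f : X ⟶ Y) :
    S.Factors f ↔ f ≫ cokernel.π S.arrow = 0 := by
  refine ⟨fun h => ?_, fun h => ?_⟩
  · rw [← S.factorThru_arrow f h, Category.assoc, cokernel.condition, comp_zero]
  · rw [← Abelian.monoLift_comp S.arrow f h]
    exact Subobject.factors_comp_arrow _

theorem factors_of_epi_comp {W X Y : C} (S : Subobject Y) (p : W ⟶ X) [Epi p] (f : X ⟶ Y)
    (h : S.Factors (p ≫ f)) : S.Factors f := by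
  rw [factors_iff_comp_cokernel_eq_zero] at h ⊢
  rwa [Category.assoc, ← comp_zero (f := p), cancel_epi] at h

/-- Element chase up to epimorphic refinement: a section `s` of `S` has the same image in `Z` as
some `t` in `T`; then `s - t` comes from `X` and lies in `S`, hence in `T`, and so does `s`. -/
theorem le_of_pullback_le_of_image_le {X Y Z : C} (f : X ⟶ Y) (g : Y ⟶ Z) (w : f ≫ g = 0)
    (hex : (ShortComplex.mk f g w).Exact) {S T : Subobject Y} (hTS : T ≤ S)
    (hf : (Subobject.pullback f).obj S ≤ (Subobject.pullback f).obj T)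
    (hg : imageSubobject (S.arrow ≫ g) ≤ imageSubobject (T.arrow ≫ g)) : S ≤ T := by
  obtain ⟨A, p, _, t, ht⟩ := surjective_up_to_refinements_of_epi
    (factorThruImageSubobject (T.arrow ≫ g))
    (factorThruImageSubobject (S.arrow ≫ g) ≫ Subobject.ofLE _ _ hg)
  have ht : p ≫ S.arrow ≫ g = t ≫ T.arrow ≫ g := by
    simpa using ht =≫ (imageSubobject (T.arrow ≫ g)).arrow
  obtain ⟨B, q, _, x, hx⟩ := hex.exact_up_to_refinements (p ≫ S.arrow - t ≫ T.arrow)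
    (by simp [Preadditive.sub_comp, ht])
  have hx : q ≫ p ≫ S.arrow - q ≫ t ≫ T.arrow = x ≫ f := by
    simpa [Preadditive.comp_sub] using hx
  have hT (k : B ⟶ (T : C)) : T.Factors (k ≫ T.arrow) := Subobject.factors_comp_arrow k
  have hxS : S.Factors (x ≫ f) := by
    rw [← hx, ← Subobject.ofLE_arrow hTS]
    simp only [← Category.assoc, ← Preadditive.sub_comp]
    exact Subobject.factors_comp_arrow _
  have hxT : T.Factors (x ≫ f) :=
    (pullback_factors_iff _ _ _).1
      (Subobject.factors_of_le _ hf ((pullback_factors_iff _ _ _).2 hxS))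
  refine Subobject.le_of_factors (factors_of_epi_comp T (q ≫ p) _ ?_)
  rw [Category.assoc, ← sub_add_cancel (q ≫ p ≫ S.arrow) (q ≫ t ≫ T.arrow), hx]
  refine Subobject.factors_add _ _ hxT ?_
  simpa using hT (q ≫ t)

/-- A subobject of the middle term of an exact sequence is determined by its trace on the left and
its image on the right, in a strictly monotone way. -/
theorem strictMono_pullback_image {X Y Z : C} (f : X ⟶ Y) (g : Y ⟶ Z) (w : f ≫ g = 0)
    (hex : (ShortComplex.mk f g w).Exact) :
    StrictMono fun S : Subobject Y =>
      ((Subobject.pullback f).obj S, imageSubobject (S.arrow ≫ g)) := by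
  have hle : ∀ {S T : Subobject Y}, S ≤ T →
      imageSubobject (S.arrow ≫ g) ≤ imageSubobject (T.arrow ≫ g) := fun {S T} h => by
    rw [← Subobject.ofLE_arrow h, Category.assoc]
    exact imageSubobject_comp_le _ _
  refine fun S T h => lt_of_le_not_ge ⟨(Subobject.pullback f).monotone h.le, hle h.le⟩ fun h' => ?_
  exact h.not_ge (le_of_pullback_le_of_image_le f g w hex h.le h'.1 h'.2)

theorem isNoetherianObject_of_exact {X Y Z : C} (f : X ⟶ Y) (g : Y ⟶ Z) (w : f ≫ g = 0)
    (hex : (ShortComplex.mk f g w).Exact) (hX : isNoetherianObject X)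
    (hZ : isNoetherianObject Z) : isNoetherianObject Y := by
  have : WellFoundedGT (Subobject X) := hX
  have : WellFoundedGT (Subobject Z) := hZ
  exact (strictMono_pullback_image f g w hex).wellFoundedGT

theorem isArtinianObject_of_exact {X Y Z : C} (f : X ⟶ Y) (g : Y ⟶ Z) (w : f ≫ g = 0)
    (hex : (ShortComplex.mk f g w).Exact) (hX : isArtinianObject X)
    (hZ : isArtinianObject Z) : isArtinianObject Y := by
  have : WellFoundedLT (Subobject X) := hX
  have : WellFoundedLT (Subobject Z) := hZ
  exact (strictMono_pullback_image f g w hex).wellFoundedLT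

/-- A property of objects which holds for zero objects and is closed under extensions and
isomorphisms passes to quotients of finite coproducts, as soon as it holds for all the quotients
of the summands. -/
theorem prop_of_epi_sigma (Q : ObjectProperty C) (h0 : ∀ X, IsZero X → Q X)
    (hext : ∀ {X Y Z : C} (f : X ⟶ Y) (g : Y ⟶ Z) (w : f ≫ g = 0),
      (ShortComplex.mk f g w).Exact → Q X → Q Z → Q Y)
    (n : ℕ) (h : Fin n → C) (hQ : ∀ i, Q (h i)) (Y : C) (p : (∐ h) ⟶ Y) [Epi p] : Q Y := by
  induction n generalizing Y with
  | zero =>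
    refine h0 Y ((IsZero.iff_id_eq_zero Y).2 ?_)
    rw [← cancel_epi p]
    exact Sigma.hom_ext _ _ fun i => i.elim0
  | succ n ih =>
    let q : (∐ fun i : Fin n => h i.succ) ⟶ cokernel (Sigma.ι h 0 ≫ p) :=
      Sigma.desc fun i => Sigma.ι h i.succ ≫ p ≫ cokernel.π _
    have : Epi q := by
      refine ⟨fun {W} a b hab => ?_⟩
      rw [← cancel_epi (cokernel.π (Sigma.ι h 0 ≫ p)), ← cancel_epi p]
      refine Sigma.hom_ext _ _ fun i => ?_
      refine Fin.cases ?_ (fun j => ?_) i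
      · simp only [← Category.assoc, cokernel.condition, zero_comp]
      · simpa [q] using (Sigma.ι (fun i : Fin n => h i.succ) j) ≫= hab
    exact hext (Sigma.ι h 0 ≫ p) (cokernel.π _) (cokernel.condition _)
      (ShortComplex.exact_cokernel _) (hQ 0) (ih _ (fun i => hQ i.succ) _ q)

/-- The ascending chain condition provides a maximal proper subobject `K`. A subobject of the
quotient pulls back to one containing `K`, so to `K` or `⊤`. -/
theorem exists_mono_simple_cokernel {Y : C} (hY : isNoetherianObject Y) (h0 : ¬ IsZero Y) :
    ∃ K : Subobject Y, K < ⊤ ∧ Simple (cokernel K.arrow) := by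
  have : WellFoundedGT (Subobject Y) := hY
  have : Nontrivial (Subobject Y) := by
    refine ⟨⊥, ⊤, fun h => h0 ?_⟩
    have : (⊤ : Subobject Y).Factors (𝟙 Y) := Subobject.top_factors _
    rw [← h, Subobject.bot_factors_iff_zero] at this
    exact (IsZero.iff_id_eq_zero Y).2 this
  obtain ⟨K, hK⟩ : ∃ K : Subobject Y, IsCoatom K := IsCoatomic.exists_coatom _
  refine ⟨K, hK.lt_top, ⟨fun {A} i _ => ⟨fun hi h => ?_, fun hi => ?_⟩⟩⟩
  · subst h
    have hz : IsZero (cokernel K.arrow) := by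
      rw [IsZero.iff_id_eq_zero, ← cancel_epi (0 : A ⟶ cokernel K.arrow)]
      simp
    refine hK.1 (top_le_iff.1 (Subobject.le_of_factors ?_))
    rw [factors_iff_comp_cokernel_eq_zero]
    exact hz.eq_of_tgt _ _
  · have hle : K ≤ (Subobject.pullback (cokernel.π K.arrow)).obj (Subobject.mk i) := by
      refine Subobject.le_of_factors ((pullback_factors_iff _ _ _).2 ?_)
      rw [cokernel.condition]
      exact Subobject.factors_zero
    rcases hle.eq_or_lt with h | h
    · exfalso
      apply hi
      obtain ⟨A', q, _, x, hx⟩ :=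
        surjective_up_to_refinements_of_epi (cokernel.π K.arrow) i
      have hxi : (Subobject.mk i).Factors (x ≫ cokernel.π K.arrow) := by
        rw [← hx]
        exact Subobject.factors_of_factors_right _ (Subobject.mk_factors_self i)
      rw [← pullback_factors_iff, ← h, factors_iff_comp_cokernel_eq_zero] at hxi
      rwa [← cancel_epi q, comp_zero, hx]
    · have ht := hK.2 _ h
      have : (Subobject.mk i).Factors (cokernel.π K.arrow) := by
        rw [← Category.id_comp (cokernel.π K.arrow), ← pullback_factors_iff, ht]
        exact Subobject.top_factors _
      have hf : (Subobject.mk i).Factors (𝟙 _) := by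
        refine factors_of_epi_comp _ (cokernel.π K.arrow) _ ?_
        rwa [Category.comp_id]
      have : Epi ((Subobject.underlyingIso i).hom ≫ i) := by
        rw [Subobject.underlyingIso_hom_comp_eq_mk]
        exact epi_of_epi_fac (Subobject.factorThru_arrow _ _ hf)
      have : Epi i := epi_of_epi (Subobject.underlyingIso i).hom i
      exact isIso_of_mono_of_epi i

theorem HasFiniteLength.of_iso {X Y : C} (e : X ≅ Y) (h : HasFiniteLength X) :
    HasFiniteLength Y := by
  cases h with
  | of_isZero hX => exact .of_isZero (hX.of_iso e.symm)
  | of_simple_cokernel f hf hs hX =>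
    exact .of_simple_cokernel (f ≫ e.hom) inferInstance
      (Simple.of_iso (cokernelCompIsIso f e.hom)) hX

/-- Noetherian and artinian objects of an abelian category have finite length. -/
theorem hasFiniteLength_of_isNoetherianObject_of_isArtinianObject {Y : C}
    (hN : isNoetherianObject Y) (hA : isArtinianObject Y) : HasFiniteLength Y := by
  have : WellFoundedLT (Subobject Y) := hA
  suffices h : ∀ S : Subobject Y, HasFiniteLength (S : C) from
    (h ⊤).of_iso (asIso (⊤ : Subobject Y).arrow)
  intro S
  -- The artinian condition drives the descent; the noetherian condition, inherited by `S`, supplies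
  -- a subobject with simple quotient at each stage.
  induction S using WellFoundedLT.induction with
  | ind S ih =>
    by_cases h0 : IsZero (S : C)
    · exact .of_isZero h0
    · obtain ⟨K, hK, hs⟩ :=
        exists_mono_simple_cokernel (isNoetherianObject.prop_of_mono S.arrow hN) h0
      have hlt : Subobject.mk (K.arrow ≫ S.arrow) < S := by
        refine lt_of_le_of_ne (Subobject.mk_le_of_comm K.arrow rfl) fun h => hK.ne ?_
        have hS : (Subobject.mk (K.arrow ≫ S.arrow)).Factors S.arrow :=
          Subobject.factors_of_le _ h.ge (Subobject.factors_self S)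
        have hid : (Subobject.factorThru _ _ hS ≫ (Subobject.underlyingIso _).hom) ≫ K.arrow =
            𝟙 _ := by
          rw [← cancel_mono S.arrow, Category.assoc, Category.assoc,
            Subobject.underlyingIso_hom_comp_eq_mk, Subobject.factorThru_arrow, Category.id_comp]
        refine top_le_iff.1 (Subobject.le_of_factors ?_)
        rw [← Category.comp_id (⊤ : Subobject (S : C)).arrow, ← hid, ← Category.assoc]
        exact Subobject.factors_comp_arrow _
      exact .of_simple_cokernel K.arrow inferInstance hs
        ((ih _ hlt).of_iso (Subobject.underlyingIso (K.arrow ≫ S.arrow)))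

end AbelianCategory

/-- Used for the inclusion of `rep` into `Rep`, so that chain conditions descend to `rep`. -/
theorem strictMono_subobject_mk_map {C : Type*} [Category* C] {D : Type*} [Category* D]
    (G : C ⥤ D) [G.Full] [G.Faithful] [G.PreservesMonomorphisms] (Y : C) :
    StrictMono fun S : Subobject Y => Subobject.mk (G.map S.arrow) := by
  refine strictMono_of_le_iff_le fun S T => ⟨fun h => ?_, fun h => ?_⟩
  · exact Subobject.mk_le_mk_of_comm (G.map (Subobject.ofLE S T h)) (by simp [← G.map_comp])
  · refine Subobject.le_of_comm (G.preimage (Subobject.ofMkLEMk _ _ h)) (G.map_injective ?_)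
    simp

/-! ### Yoneda and maps between representables. -/

section Representable

variable {P : Type u} [PartialOrder P] {F : Type v} [Field F]

/-- The morphism from a representable functor that corresponds to an element under the
Yoneda lemma. -/
def ofElement (M : Rep P F) (y : P) (m : M.obj (op y)) : representable F y ⟶ M where
  app z := ModuleCat.ofHom (Finsupp.linearCombination F fun g : z.unop ⟶ y => M.map g.op m)
  naturality z z' f := by
    ext : 1
    refine Finsupp.lhom_ext' fun k => LinearMap.ext_ring ?_
    change Finsupp.linearCombination F (fun g : z'.unop ⟶ y => M.map g.op m)
      (Finsupp.mapDomain (fun g => f.unop ≫ g) (Finsupp.single k 1)) =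
      M.map f (Finsupp.linearCombination F (fun g : z.unop ⟶ y => M.map g.op m)
        (Finsupp.single k 1))
    simp [Finsupp.mapDomain_single]

theorem ofElement_app_single (M : Rep P F) (y : P) (m : M.obj (op y)) {z : P} (k : z ⟶ y) :
    (ofElement M y m).app (op z) (Finsupp.single k (1 : F) : (z ⟶ y) →₀ F) = M.map k.op m := by
  change Finsupp.linearCombination F (fun g : z ⟶ y => M.map g.op m) (Finsupp.single k 1) = _
  simp

theorem representable_map_single {x y z : P} (k : y ⟶ x) (l : z ⟶ y) :
    (representable F x).map l.op (Finsupp.single k (1 : F) : (y ⟶ x) →₀ F) =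
      (Finsupp.single (l ≫ k) (1 : F) : (z ⟶ x) →₀ F) :=
  Finsupp.mapDomain_single

variable (F) in
/-- The universal element of a representable functor. -/
def universalElement (y : P) : (representable F y).obj (op y) :=
  (Finsupp.single (𝟙 y) (1 : F) : (y ⟶ y) →₀ F)

@[simp]
theorem ofElement_universalElement (M : Rep P F) (y : P) (m : M.obj (op y)) :
    (ofElement M y m).app (op y) (universalElement F y) = m := by
  refine (ofElement_app_single M y m (𝟙 y)).trans ?_
  simp

theorem representable_hom_ext {M : Rep P F} {y : P} {f g : representable F y ⟶ M}
    (h : f.app (op y) (universalElement F y) = g.app (op y) (universalElement F y)) : f = g := by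
  ext z : 3
  refine Finsupp.lhom_ext' fun k => LinearMap.ext_ring ?_
  have hk : (Finsupp.single k (1 : F) : (z.unop ⟶ y) →₀ F) =
      (representable F y).map k.op (universalElement F y) := by
    refine ((representable_map_single (F := F) (𝟙 y) k).trans ?_).symm
    rw [Category.comp_id]
  change f.app z (Finsupp.single k (1 : F) : (z.unop ⟶ y) →₀ F) =
    g.app z (Finsupp.single k (1 : F) : (z.unop ⟶ y) →₀ F)
  rw [hk]
  have hf := NatTrans.naturality_apply f k.op (universalElement F y)
  have hg := NatTrans.naturality_apply g k.op (universalElement F y)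
  exact hf.trans ((congrArg _ h).trans hg.symm)

theorem hom_ext_of_representable {M N : Rep P F} {f g : M ⟶ N}
    (h : ∀ (y : P) (k : representable F y ⟶ M), k ≫ f = k ≫ g) : f = g := by
  ext z m
  have := congrArg (fun k => k.app z (universalElement F z.unop)) (h z.unop (ofElement M z.unop m))
  have e := ofElement_universalElement M z.unop m
  simpa [e] using this

theorem surjective_app_of_epi {M N : Rep P F} (f : M ⟶ N) [Epi f] (z : Pᵒᵖ) :
    Function.Surjective (f.app z) :=
  (ModuleCat.epi_iff_surjective _).1 inferInstance

instance projective_representable (y : P) : Projective (representable F y) where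
  factors {E X} f e _ := by
    obtain ⟨m, hm⟩ := surjective_app_of_epi e (op y) (f.app (op y) (universalElement F y))
    exact ⟨ofElement E y m, representable_hom_ext (by simp [hm])⟩

theorem factors_of_forall_representable {M N : Rep P F} (S : Subobject N) (f : M ⟶ N)
    (h : ∀ (y : P) (k : representable F y ⟶ M), S.Factors (k ≫ f)) : S.Factors f := by
  rw [factors_iff_comp_cokernel_eq_zero]
  refine hom_ext_of_representable fun y k => ?_
  rw [comp_zero, ← Category.assoc]
  exact (factors_iff_comp_cokernel_eq_zero _ _).1 (h y k)

variable (F) in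
/-- The morphism of representable functors given by an inequality. -/
def representableMap {y x : P} (h : y ≤ x) : representable F y ⟶ representable F x :=
  ofElement _ y (Finsupp.single (homOfLE h) (1 : F) : (y ⟶ x) →₀ F)

theorem representableMap_universalElement {y x : P} (h : y ≤ x) :
    (representableMap F h).app (op y) (universalElement F y) =
      (Finsupp.single (homOfLE h) (1 : F) : (y ⟶ x) →₀ F) :=
  ofElement_universalElement _ _ _

theorem representableMap_comp {z y x : P} (h : z ≤ y) (h' : y ≤ x) :
    representableMap F h ≫ representableMap F h' = representableMap F (h.trans h') := by
  refine representable_hom_ext ?_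
  refine Eq.trans ?_ (representableMap_universalElement _).symm
  rw [NatTrans.comp_app, ModuleCat.comp_apply, representableMap_universalElement]
  exact (ofElement_app_single _ _ _ _).trans (representable_map_single _ _)

theorem subsingleton_representable_obj {y x : P} (h : ¬ y ≤ x) :
    Subsingleton ((representable F x).obj (op y)) := by
  have : IsEmpty (y ⟶ x) := ⟨fun g => h (leOfHom g)⟩
  exact inferInstanceAs (Subsingleton ((y ⟶ x) →₀ F))

theorem nontrivial_representable_obj {y x : P} (h : y ≤ x) :
    Nontrivial ((representable F x).obj (op y)) := by
  have : Nonempty (y ⟶ x) := ⟨homOfLE h⟩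
  exact inferInstanceAs (Nontrivial ((y ⟶ x) →₀ F))

theorem representableMap_ne_zero {y x : P} (h : y ≤ x) : representableMap F h ≠ 0 := by
  intro h0
  have := congrArg (fun k => k.app (op y) (universalElement F y)) h0
  exact one_ne_zero (Finsupp.single_eq_zero.1
    ((representableMap_universalElement h).symm.trans this))

/-- By Yoneda such a map is an element of the free module on `y ⟶ x`, which has at most one element
in a poset. -/
theorem exists_eq_smul_representableMap {y x : P} (h : y ≤ x)
    (f : representable F y ⟶ representable F x) : ∃ c : F, f = c • representableMap F h := by
  let m : (y ⟶ x) →₀ F := f.app (op y) (universalElement F y)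
  refine ⟨m (homOfLE h), representable_hom_ext ?_⟩
  have hm : m = m (homOfLE h) • Finsupp.single (homOfLE h) (1 : F) := by
    ext k
    simp [Subsingleton.elim k (homOfLE h)]
  exact hm.trans (congrArg (m (homOfLE h) • ·) (representableMap_universalElement h).symm)

/-! ### Subobjects of `h_x` and ideals of `↓x`. -/

theorem factors_smul {M N : Rep P F} {S : Subobject N} {f : M ⟶ N} (h : S.Factors f) (c : F) :
    S.Factors (c • f) := by
  rw [factors_iff_comp_cokernel_eq_zero] at h ⊢
  rw [Linear.smul_comp, h, smul_zero]

/-- The ideal of the elements below `x` at which a subfunctor of `h_x` does not vanish. -/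
def lowerSetOfSubobject (x : P) (S : Subobject (representable F x)) : LowerSet (Set.Iic x) where
  carrier := {y | S.Factors (representableMap F y.2)}
  lower' := fun y z h hy => by
    have h' : (z : P) ≤ y := h
    have := Subobject.factors_of_factors_right (representableMap F h') hy
    rwa [representableMap_comp h' y.2] at this

/-- A map `h_y ⟶ T` followed by the inclusion is zero or a nonzero multiple of the canonical map, so
the ideal of `T` decides which such maps factor through `S`. -/
theorem strictMono_lowerSetOfSubobject (x : P) :
    StrictMono (lowerSetOfSubobject (F := F) x) := by
  refine fun S T h => lt_of_le_not_ge (fun y hy => Subobject.factors_of_le _ h.le hy) fun h' => ?_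
  refine h.not_ge (Subobject.le_of_factors (factors_of_forall_representable _ _ fun y k => ?_))
  by_cases hyx : y ≤ x
  · obtain ⟨c, hc⟩ := exists_eq_smul_representableMap hyx (k ≫ T.arrow)
    rcases eq_or_ne c 0 with rfl | h0
    · rw [hc, zero_smul]
      exact Subobject.factors_zero
    · rw [hc]
      refine factors_smul (h' (?_ : (⟨y, hyx⟩ : Set.Iic x) ∈ lowerSetOfSubobject x T)) c
      change T.Factors (representableMap F hyx)
      rw [← inv_smul_smul₀ h0 (representableMap F hyx), ← hc]
      exact factors_smul (Subobject.factors_comp_arrow _) _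
  · have := subsingleton_representable_obj (F := F) hyx
    rw [show k ≫ T.arrow = 0 from representable_hom_ext (Subsingleton.elim _ _)]
    exact Subobject.factors_zero

/-! ### Finite presentation and its closure properties. -/

instance projective_sigma_representable {ι : Type*} [Finite ι] (a : ι → P) :
    Projective (∐ fun i => representable F (a i)) where
  factors f e _ := ⟨Sigma.desc fun i =>
      Projective.factorThru (Sigma.ι (fun i => representable F (a i)) i ≫ f) e,
    Sigma.hom_ext _ _ fun i => by simp⟩

theorem isFinitelyPresented_of_isColimit {ι κ : Type*} [Finite ι] [Finite κ] {M : Rep P F}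
    (a : ι → P) (b : κ → P)
    (f : (∐ fun i => representable F (a i)) ⟶ ∐ fun j => representable F (b j))
    (c : CokernelCofork f) (hc : IsColimit c) (e : M ≅ c.pt) : IsFinitelyPresented P F M := by
  obtain ⟨m, ⟨eι⟩⟩ := Finite.exists_equiv_fin ι
  obtain ⟨n, ⟨eκ⟩⟩ := Finite.exists_equiv_fin κ
  let i₁ : (∐ fun i => representable F (a i)) ≅ ∐ fun i => representable F (a (eι.symm i)) :=
    Sigma.whiskerEquiv eι fun i => eqToIso (by simp)
  let i₂ : (∐ fun i => representable F (b i)) ≅ ∐ fun i => representable F (b (eκ.symm i)) :=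
    Sigma.whiskerEquiv eκ fun i => eqToIso (by simp)
  refine ⟨m, n, a ∘ eι.symm, b ∘ eκ.symm, i₁.inv ≫ f ≫ i₂.hom, ⟨e ≪≫ ?_⟩⟩
  exact hc.coconePointUniqueUpToIso (cokernelIsCokernel f) ≪≫
    cokernel.mapIso f _ i₁ i₂ (by simp)

variable (F) in
theorem isFinitelyPresented_representable (x : P) :
    IsFinitelyPresented P F (representable F x) := by
  have hπ : Sigma.ι (fun _ : Unit => representable F x) () ≫
      Sigma.desc (fun _ : Unit => 𝟙 (representable F x)) = 𝟙 _ := by simp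
  have hd : Sigma.desc (fun _ : Unit => 𝟙 (representable F x)) ≫
      Sigma.ι (fun _ : Unit => representable F x) () = 𝟙 _ :=
    Sigma.hom_ext _ _ fun _ => by simp
  refine isFinitelyPresented_of_isColimit (F := F) (ι := Empty) (κ := Unit) (fun i => i.elim)
    (fun _ => x) 0 _ (cokernelIsCokernel _) (?_ ≪≫ (cokernelZeroIsoTarget).symm)
  exact ⟨_, _, hπ, hd⟩

/-- Finite presentation is inherited by the cokernel of a morphism from a finitely generated
representation. -/
theorem isFinitelyPresented_cokernel {l : ℕ} (c : Fin l → P) {X Y : Rep P F}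
    (q : (∐ fun i => representable F (c i)) ⟶ X) [Epi q] (g : X ⟶ Y)
    (hY : IsFinitelyPresented P F Y) : IsFinitelyPresented P F (cokernel g) := by
  obtain ⟨m, n, a, b, φ, ⟨e⟩⟩ := hY
  let π := cokernel.π φ ≫ e.inv
  -- The generators of `X` are lifted by projectivity to the generators of `Y`; these lifts, added
  -- to the relations of `Y`, present the cokernel.
  obtain ⟨r, hr⟩ : ∃ r, r ≫ π = q ≫ g :=
    ⟨Projective.factorThru (q ≫ g) π, Projective.factorThru_comp _ _⟩
  let f : (∐ fun s : Fin m ⊕ Fin l => representable F (Sum.elim a c s)) ⟶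
      ∐ fun j => representable F (b j) :=
    Sigma.desc fun s => match s with
      | .inl i => Sigma.ι (fun i => representable F (a i)) i ≫ φ
      | .inr i => Sigma.ι (fun i => representable F (c i)) i ≫ r
  have hinl {W : Rep P F} (k : _ ⟶ W) (i : Fin m) :
      Sigma.ι (fun s => representable F (Sum.elim a c s)) (.inl i) ≫ f ≫ k =
        Sigma.ι (fun i => representable F (a i)) i ≫ φ ≫ k :=
    (Category.assoc _ _ _).symm.trans
      ((congrArg (· ≫ k) (Sigma.ι_desc _ _)).trans (Category.assoc _ _ _))
  have hinr {W : Rep P F} (k : _ ⟶ W) (i : Fin l) :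
      Sigma.ι (fun s => representable F (Sum.elim a c s)) (.inr i) ≫ f ≫ k =
        Sigma.ι (fun i => representable F (c i)) i ≫ r ≫ k :=
    (Category.assoc _ _ _).symm.trans
      ((congrArg (· ≫ k) (Sigma.ι_desc _ _)).trans (Category.assoc _ _ _))
  have hφπ : φ ≫ π ≫ cokernel.π g = 0 := by simp [π]
  have hrπ : r ≫ π ≫ cokernel.π g = 0 := by rw [reassoc_of% hr, cokernel.condition, comp_zero]
  have w : f ≫ π ≫ cokernel.π g = 0 := by
    refine Sigma.hom_ext _ _ fun s => ?_
    rw [comp_zero]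
    rcases s with i | i
    · exact (hinl _ i).trans (by rw [hφπ, comp_zero]; rfl)
    · exact (hinr _ i).trans (by rw [hrπ, comp_zero]; rfl)
  refine isFinitelyPresented_of_isColimit _ _ f (CokernelCofork.ofπ (π ≫ cokernel.π g) w)
    (CokernelCofork.IsColimit.ofπ' _ _ fun {W} k hk => ?_) (Iso.refl _)
  have hφ : φ ≫ k = 0 := Sigma.hom_ext _ _ fun i => by
    rw [← hinl, hk, comp_zero, comp_zero]; rfl
  have hrk : r ≫ k = 0 := Sigma.hom_ext _ _ fun i => by
    rw [← hinr, hk, comp_zero, comp_zero]; rfl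
  have hk' : π ≫ e.hom ≫ cokernel.desc φ k hφ = k := by simp [π]
  have hg : g ≫ e.hom ≫ cokernel.desc φ k hφ = 0 := by
    rw [← cancel_epi q, ← Category.assoc, ← hr, Category.assoc, hk', hrk, comp_zero]
  exact ⟨cokernel.desc g _ hg, by rw [Category.assoc, cokernel.π_desc, hk']⟩

theorem IsFinitelyPresented.cokernel {X Y : Rep P F} (hX : IsFinitelyPresented P F X)
    (hY : IsFinitelyPresented P F Y) (g : X ⟶ Y) : IsFinitelyPresented P F (cokernel g) := by
  obtain ⟨m, n, a, b, φ, ⟨e⟩⟩ := hX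
  exact isFinitelyPresented_cokernel b (cokernel.π φ ≫ e.inv) g hY

/-- Noetherian representations are finitely generated. -/
theorem exists_epi_of_isNoetherianObject {M : Rep P F} (hM : isNoetherianObject M) :
    ∃ s : Finset (Σ y : P, representable F y ⟶ M),
      Epi (Sigma.desc fun i : s => i.1.2) := by
  classical
  have : WellFoundedGT (Subobject M) := hM
  let im (s : Finset (Σ y : P, representable F y ⟶ M)) : Subobject M :=
    imageSubobject (Sigma.desc fun i : s => i.1.2)
  -- A finite family with maximal image: adjoining any further map cannot enlarge the image, so
  -- every map from a representable already factors through it.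
  obtain ⟨s, hs⟩ : ∃ s, ∀ t, ¬ im s < im t := by
    obtain ⟨_, ⟨s, rfl⟩, hs⟩ := wellFounded_gt.has_min (Set.range im) ⟨_, ⟨∅, rfl⟩⟩
    exact ⟨s, fun t => hs _ ⟨t, rfl⟩⟩
  have mono {s t : Finset (Σ y : P, representable F y ⟶ M)} (h : s ⊆ t) : im s ≤ im t := by
    have : Sigma.desc (fun i : s => i.1.2) =
        Sigma.desc (fun i : s => Sigma.ι (fun i : t => representable F i.1.1) ⟨i.1, h i.2⟩) ≫
          Sigma.desc (fun i : t => i.1.2) := Sigma.hom_ext _ _ fun i => by simp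
    dsimp only [im]
    rw [this]
    exact imageSubobject_comp_le _ _
  have htop : (im s).Factors (𝟙 M) := by
    refine factors_of_forall_representable _ _ fun y k => ?_
    rw [Category.comp_id]
    have hk : (im (insert ⟨y, k⟩ s)).Factors k := by
      have := imageSubobject_factors_comp_self
        (f := Sigma.desc fun i : ↥(insert (⟨y, k⟩ : Σ y : P, representable F y ⟶ M) s) => i.1.2)
        (Sigma.ι (fun i : ↥(insert (⟨y, k⟩ : Σ y : P, representable F y ⟶ M) s) =>
          representable F i.1.1) ⟨⟨y, k⟩, Finset.mem_insert_self _ _⟩)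
      rwa [Sigma.ι_desc] at this
    rwa [← (mono (Finset.subset_insert _ _)).eq_of_not_lt (hs _)] at hk
  refine ⟨s, ?_⟩
  have : Epi (im s).arrow := epi_of_epi_fac (Subobject.factorThru_arrow _ _ htop)
  rw [← imageSubobject_arrow_comp (Sigma.desc fun i : s => i.1.2)]
  exact epi_comp _ _

theorem isNoetherianObject_of_epi_sigma (hP : ∀ x : P, isNoetherianObject (representable F x))
    {n : ℕ} (b : Fin n → P) {M : Rep P F} (p : (∐ fun i => representable F (b i)) ⟶ M) [Epi p] :
    isNoetherianObject M :=
  prop_of_epi_sigma isNoetherianObject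
    (fun _ h => isNoetherianObject.is_iff _ |>.1 (isNoetherianObject_of_isZero h))
    isNoetherianObject_of_exact n _ (fun i => hP (b i)) M p

/-- A noetherian `M` is finitely generated, and the kernel of a finite cover is again noetherian,
hence finitely generated. Conversely, quotients of finite sums of noetherian objects are noetherian.
-/
theorem isFinitelyPresented_eq_isNoetherianObject
    (hP : ∀ x : P, isNoetherianObject (representable F x)) :
    IsFinitelyPresented P F = isNoetherianObject := by
  ext M
  refine ⟨fun ⟨m, n, a, b, f, ⟨e⟩⟩ => ?_, fun hM => ?_⟩
  · exact isNoetherianObject_of_epi_sigma hP b (cokernel.π f ≫ e.inv)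
  · obtain ⟨s, hs⟩ := exists_epi_of_isNoetherianObject hM
    let b (i : s) : P := i.1.1
    let p : (∐ fun i => representable F (b i)) ⟶ M := Sigma.desc fun i : s => i.1.2
    have : Epi p := hs
    have hker : isNoetherianObject (kernel p) := by
      let e : (∐ fun i => representable F (b i)) ≅
          ∐ fun i => representable F (b (s.equivFin.symm i)) :=
        Sigma.whiskerEquiv s.equivFin fun i => eqToIso (by simp)
      exact isNoetherianObject.prop_of_mono (kernel.ι p)
        (isNoetherianObject_of_epi_sigma hP (b ∘ s.equivFin.symm) e.inv)
    obtain ⟨t, ht⟩ := exists_epi_of_isNoetherianObject hker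
    let q : (∐ fun i : t => representable F i.1.1) ⟶ kernel p := Sigma.desc fun i : t => i.1.2
    have : Epi q := ht
    exact isFinitelyPresented_of_isColimit _ b (q ≫ kernel.ι p) _
      (isCokernelEpiComp (Abelian.epiIsCokernelOfKernel _ (kernelIsKernel p)) q rfl) (Iso.refl _)

/-- If the representable functors are noetherian, the finitely presented representations form an
abelian category, with kernels and cokernels computed in the category of all representations. -/
@[reducible]
def abelianFpRep (hP : ∀ x : P, isNoetherianObject (representable F x)) :
    Abelian (FpRep P F) := by
  have h := isFinitelyPresented_eq_isNoetherianObject hP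
  have hext {X Y Z : Rep P F} (f : X ⟶ Y) (g : Y ⟶ Z) (w : f ≫ g = 0)
      (hex : (ShortComplex.mk f g w).Exact) (hX : IsFinitelyPresented P F X)
      (hZ : IsFinitelyPresented P F Z) : IsFinitelyPresented P F Y := by
    rw [h] at hX hZ ⊢
    exact isNoetherianObject_of_exact f g w hex hX hZ
  have : (IsFinitelyPresented P F).IsClosedUnderSubobjects := by
    rw [h]
    infer_instance
  have : (IsFinitelyPresented P F).ContainsZero := by
    rw [h]
    infer_instance
  have : (IsFinitelyPresented P F).IsClosedUnderCokernels := ⟨by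
    rintro _ ⟨f, k, hk, hf⟩
    obtain ⟨m, n, a, b, φ, ⟨e⟩⟩ := hf.1.cokernel hf.2 f
    exact ⟨m, n, a, b, φ, ⟨hk.coconePointUniqueUpToIso (cokernelIsCokernel f) ≪≫ e⟩⟩⟩
  have : (IsFinitelyPresented P F).IsClosedUnderBinaryProducts := ⟨by
    rintro X ⟨p⟩
    have hb := hext biprod.inl biprod.snd biprod.inl_snd
      (ShortComplex.Splitting.ofHasBinaryBiproduct _ _).shortExact.exact
      (p.prop_diag_obj (.mk .left)) (p.prop_diag_obj (.mk .right))
    refine (IsFinitelyPresented P F).prop_of_iso (biprod.isoProd _ _ ≪≫ ?_) hb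
    exact IsLimit.conePointUniqueUpToIso (prodIsProd _ _)
      ((IsLimit.postcomposeHomEquiv (diagramIsoPair p.diag) _).2 p.isLimit)⟩
  have : (IsFinitelyPresented P F).IsClosedUnderFiniteProducts :=
    ObjectProperty.IsClosedUnderFiniteProducts.mk'
  infer_instance

theorem isNoetherianObject_representable (x : P) [WellFoundedGT (LowerSet (Set.Iic x))] :
    isNoetherianObject (representable F x) :=
  (strictMono_lowerSetOfSubobject x).wellFoundedGT

theorem isArtinianObject_representable (x : P) [WellFoundedLT (LowerSet (Set.Iic x))] :
    isArtinianObject (representable F x) :=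
  (strictMono_lowerSetOfSubobject x).wellFoundedLT

theorem preservesMonomorphisms_ι_fpRep (hP : ∀ x : P, isNoetherianObject (representable F x)) :
    (IsFinitelyPresented P F).ι.PreservesMonomorphisms := by
  rw [isFinitelyPresented_eq_isNoetherianObject hP]
  exact isNoetherianObject.preservesMonomorphisms_ι_of_isNormalEpiCategory

theorem isNoetherianObject_fpRep (hP : ∀ x : P, isNoetherianObject (representable F x))
    (X : FpRep P F) : isNoetherianObject X := by
  have := preservesMonomorphisms_ι_fpRep hP
  have : WellFoundedGT (Subobject ((IsFinitelyPresented P F).ι.obj X)) :=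
    (isFinitelyPresented_eq_isNoetherianObject hP).le _ X.property
  exact (strictMono_subobject_mk_map (IsFinitelyPresented P F).ι X).wellFoundedGT

theorem isArtinianObject_fpRep (hP : ∀ x : P, isNoetherianObject (representable F x))
    (hP' : ∀ x : P, isArtinianObject (representable F x)) (X : FpRep P F) :
    isArtinianObject X := by
  have := preservesMonomorphisms_ι_fpRep hP
  have : WellFoundedLT (Subobject ((IsFinitelyPresented P F).ι.obj X)) := by
    obtain ⟨m, n, a, b, f, ⟨e⟩⟩ := X.property
    exact prop_of_epi_sigma isArtinianObject
      (fun _ h => (isArtinianObject.is_iff _).1 (isArtinianObject_of_isZero h))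
      isArtinianObject_of_exact n _ (fun i => hP' (b i)) X.obj (cokernel.π f ≫ e.inv)
  exact (strictMono_subobject_mk_map (IsFinitelyPresented P F).ι X).wellFoundedLT

/-! ### Necessity: supports and chains, for an arbitrary abelian structure on `rep`. -/

variable (F) in
/-- The representable functor as an object of the category of finitely presented
representations. -/
def fpRepresentable (x : P) : FpRep P F :=
  ⟨representable F x, isFinitelyPresented_representable F x⟩

/-- The cokernel in the category of all representations, as a finitely presented
representation. -/
def fpCokernel {X Y : FpRep P F} (f : X ⟶ Y) : FpRep P F :=
  ⟨cokernel f.hom, X.property.cokernel Y.property f.hom⟩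

/-- The projection onto `fpCokernel`. -/
def fpCokernelπ {X Y : FpRep P F} (f : X ⟶ Y) : Y ⟶ fpCokernel f :=
  ObjectProperty.homMk (cokernel.π f.hom)

/-- The cokernel in `Rep` is itself finitely presented, so cancellation in `rep` shows that its
projection vanishes. -/
theorem epi_hom_of_epi {X Y : FpRep P F} (f : X ⟶ Y) [Epi f] : Epi f.hom := by
  refine Preadditive.epi_of_cokernel_zero (f := f.hom) ?_
  have h : fpCokernelπ f = ObjectProperty.homMk 0 := by
    rw [← cancel_epi f]
    ext : 1
    exact (cokernel.condition f.hom).trans comp_zero.symm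
  exact congrArg (·.hom) h

theorem exists_app_eq_of_cokernelπ_app_eq_zero {M N : Rep P F} (f : M ⟶ N) (z : Pᵒᵖ) (m : N.obj z)
    (hm : (cokernel.π f).app z m = 0) : ∃ l : M.obj z, f.app z l = m :=
  ((ShortComplex.exact_cokernel f).map
    ((evaluation Pᵒᵖ (ModuleCat F)).obj z)).moduleCat_range_eq_ker.ge hm

theorem subsingleton_sigma_obj {n : ℕ} (b : Fin n → Rep P F) (z : Pᵒᵖ)
    (h : ∀ i, Subsingleton ((b i).obj z)) : Subsingleton ((∐ b).obj z) := by
  refine ModuleCat.subsingleton_of_isZero ((IsZero.iff_id_eq_zero _).2 ?_)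
  refine (isColimitOfPreserves ((evaluation Pᵒᵖ (ModuleCat F)).obj z)
    (colimit.isColimit (Discrete.functor b))).hom_ext fun ⟨i⟩ => ?_
  have := ModuleCat.isZero_of_subsingleton ((b i).obj z)
  exact this.eq_of_src _ _

/-- Zero morphisms are unique, so those of a given abelian structure agree with those inherited from
`Rep`. -/
theorem fpRep_hom_eq_zero_iff [hz : HasZeroMorphisms (FpRep P F)] {X Y : FpRep P F} (f : X ⟶ Y) :
    f = 0 ↔ f.hom = 0 := by
  have h0 : (0 : X ⟶ Y).hom = 0 := by
    rw [Subsingleton.elim hz Preadditive.preadditiveHasZeroMorphisms]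
    rfl
  refine ⟨fun h => h ▸ h0, fun h => ?_⟩
  ext : 1
  rw [h, h0]

/-- A nonzero element at `y` gives an epimorphism from `h_y`, so the support lies in `↓y`; two
points of the support lie below each other. -/
theorem subsingleton_support_of_simple [HasZeroMorphisms (FpRep P F)]
    [HasEqualizers (FpRep P F)] [HasImages (FpRep P F)] {S : FpRep P F} (hS : Simple S) :
    {y : P | Nontrivial (S.obj.obj (op y))}.Subsingleton := by
  suffices h : ∀ y z : P, Nontrivial (S.obj.obj (op y)) → Nontrivial (S.obj.obj (op z)) → z ≤ y from
    fun y hy z hz => le_antisymm (h z y hz hy) (h y z hy hz)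
  intro y z hy hz
  obtain ⟨m, hm⟩ := exists_ne (0 : S.obj.obj (op y))
  let k : fpRepresentable F y ⟶ S := ObjectProperty.homMk (ofElement S.obj y m)
  have hk : k ≠ 0 := by
    rw [Ne, fpRep_hom_eq_zero_iff]
    intro h
    apply hm
    rw [← ofElement_universalElement S.obj y m]
    change (k.hom.app (op y)) _ = 0
    rw [h]
    rfl
  have : Epi k := epi_of_nonzero_to_simple hk
  have := epi_hom_of_epi k
  by_contra hzy
  have : Subsingleton ((fpRepresentable F y).obj.obj (op z)) :=
    subsingleton_representable_obj hzy
  exact not_subsingleton _ (surjective_app_of_epi k.hom (op z)).subsingleton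

/-- The projection to the `Rep` cokernel factors through the cokernel in `rep`, so it vanishes at
`z`; exactness in `Rep` then lifts each element to `X`. -/
theorem subsingleton_obj_of_cokernel [HasZeroMorphisms (FpRep P F)] {X Y : FpRep P F}
    (f : X ⟶ Y) [HasCokernel f] (z : Pᵒᵖ)
    (hX : Subsingleton (X.obj.obj z)) (hZ : Subsingleton ((cokernel f).obj.obj z)) :
    Subsingleton (Y.obj.obj z) := by
  have w : f ≫ fpCokernelπ f = 0 := by
    rw [fpRep_hom_eq_zero_iff]
    exact cokernel.condition f.hom
  have h : (cokernel.π f).hom ≫ (cokernel.desc f _ w).hom = cokernel.π f.hom :=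
    congrArg (·.hom) (cokernel.π_desc f _ w)
  refine subsingleton_of_forall_eq 0 fun m => ?_
  have hm : (cokernel.π f.hom).app z m = 0 := by
    rw [← h]
    change (cokernel.desc f _ w).hom.app z ((cokernel.π f).hom.app z m) = 0
    rw [Subsingleton.elim ((cokernel.π f).hom.app z m) 0, map_zero]
  obtain ⟨l, hl⟩ := exists_app_eq_of_cokernelπ_app_eq_zero f.hom z m hm
  rw [← hl, Subsingleton.elim l 0, map_zero]

theorem HasFiniteLength.finite_support [A : Abelian (FpRep P F)] {X : FpRep P F}
    (h : HasFiniteLength X) :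
    {y : P | Nontrivial (X.obj.obj (op y))}.Finite := by
  let _ := A.toPreadditive.preadditiveHasZeroMorphisms
  induction h with
  | of_isZero hX =>
    convert Set.finite_empty
    refine Set.eq_empty_iff_forall_notMem.2 fun y hy => not_subsingleton_iff_nontrivial.2 hy ?_
    have h := congrArg (fun f => f.hom.app (op y)) (hX.eq_of_src (𝟙 _) (ObjectProperty.homMk 0))
    exact ModuleCat.subsingleton_of_isZero ((IsZero.iff_id_eq_zero _).2 h)
  | of_simple_cokernel f hf hs hX ih =>
    refine (ih.union (subsingleton_support_of_simple hs).finite).subset fun y hy => ?_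
    by_contra h
    simp only [Set.mem_union, Set.mem_ofPred_eq, not_or, not_nontrivial_iff_subsingleton] at h
    exact not_subsingleton_iff_nontrivial.2 hy (subsingleton_obj_of_cokernel f _ h.1 h.2)

theorem HasFiniteLength.finite_Iic [Abelian (FpRep P F)] {x : P}
    (h : HasFiniteLength (fpRepresentable F x)) :
    (Set.Iic x).Finite :=
  h.finite_support.subset fun _ hy => nontrivial_representable_obj (F := F) hy

/-- The morphism to `h_x` from the sum of the first `n` functors `h_{y i}`. -/
def sigmaRepresentableDesc {x : P} {y : ℕ → P} (hy : ∀ i, y i ≤ x) (n : ℕ) :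
    (∐ fun i : Fin n => representable F (y i)) ⟶ representable F x :=
  Sigma.desc fun i : Fin n => representableMap F (hy i)

theorem ι_sigmaRepresentableDesc {x : P} {y : ℕ → P} (hy : ∀ i, y i ≤ x) {n : ℕ} (i : Fin n) :
    Sigma.ι (fun i : Fin n => representable F (y i)) i ≫ sigmaRepresentableDesc hy n =
      representableMap F (hy i) :=
  Sigma.ι_desc _ _

theorem comp_cokernelπ_eq_zero {x : P} {y : ℕ → P} (hy : ∀ i, y i ≤ x) {i n : ℕ} (h : i < n) :
    representableMap F (hy i) ≫ cokernel.π (sigmaRepresentableDesc (F := F) hy n) = 0 := by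
  rw [← ι_sigmaRepresentableDesc hy (⟨i, h⟩ : Fin n), Category.assoc, cokernel.condition, comp_zero]

/-- The sum of the earlier representables vanishes at `y n`, so the quotient map kills nothing
there. -/
theorem comp_cokernelπ_ne_zero {x : P} {y : ℕ → P} (hy : ∀ i, y i ≤ x) (n : ℕ)
    (h : ∀ i < n, ¬ y n ≤ y i) :
    representableMap F (hy n) ≫ cokernel.π (sigmaRepresentableDesc (F := F) hy n) ≠ 0 := by
  intro h0
  have hs : Subsingleton ((∐ fun i : Fin n => representable F (y i)).obj (op (y n))) :=
    subsingleton_sigma_obj _ _ fun i => subsingleton_representable_obj (h i i.2)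
  obtain ⟨l, hl⟩ := exists_app_eq_of_cokernelπ_app_eq_zero (sigmaRepresentableDesc (F := F) hy n) _
    ((representableMap F (hy n)).app (op (y n)) (universalElement F (y n)))
    (congrArg (fun k => k.app (op (y n)) (universalElement F (y n))) h0)
  refine representableMap_ne_zero (F := F) (hy n) (representable_hom_ext ?_)
  rw [← hl, Subsingleton.elim l 0, map_zero]
  rfl

/-- The finitely presented quotients of `h_x` bound the ascending chains of ideals below `x`. -/
theorem wellFoundedGT_lowerSet_of_isNoetherianObject (A : Abelian (FpRep P F)) (x : P)
    (hx : isNoetherianObject (fpRepresentable F x)) : WellFoundedGT (LowerSet (Set.Iic x)) := by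
  have : WellFoundedGT (Subobject (fpRepresentable F x)) := hx
  by_contra hI
  obtain ⟨I, hI⟩ : ∃ I : ℕ → LowerSet (Set.Iic x), StrictMono I := by
    obtain ⟨f⟩ := not_isEmpty_iff.1 fun h =>
      hI ⟨RelEmbedding.wellFounded_iff_isEmpty.2 h⟩
    exact ⟨f, fun a b h => f.map_rel_iff.2 h⟩
  have hy (n : ℕ) : ∃ y ∈ I (n + 1), y ∉ I n := Set.not_subset.1 (hI n.lt_succ_self).not_ge
  choose t ht ht' using hy
  let y (n : ℕ) : P := t n
  have hy (n : ℕ) : y n ≤ x := (t n).2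
  -- For `i < n`, `y i` lies in `I (i + 1) ≤ I n`, so `y n ≤ y i` would put `y n` in `I n`.
  have hlt (n i : ℕ) (h : i < n) : ¬ y n ≤ y i := fun hle =>
    ht' n (hI.monotone (Nat.succ_le_of_lt h) ((I (i + 1)).lower hle (ht i)))
  let _ := A.toPreadditive.preadditiveHasZeroMorphisms
  let Q (n : ℕ) : FpRep P F := ⟨cokernel (sigmaRepresentableDesc (F := F) hy n),
    isFinitelyPresented_cokernel (fun i : Fin n => y i) (𝟙 _) _
      (isFinitelyPresented_representable F x)⟩
  let q (n : ℕ) : fpRepresentable F x ⟶ Q n := ObjectProperty.homMk (cokernel.π _)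
  let j (n : ℕ) : fpRepresentable F (y n) ⟶ fpRepresentable F x :=
    ObjectProperty.homMk (representableMap F (hy n))
  have hdesc (n : ℕ) : sigmaRepresentableDesc (F := F) hy n ≫
      cokernel.π (sigmaRepresentableDesc hy (n + 1)) = 0 := Sigma.hom_ext _ _ fun i => by
    rw [← Category.assoc, ι_sigmaRepresentableDesc, comp_zero]
    exact comp_cokernelπ_eq_zero hy (i.2.trans n.lt_succ_self)
  let r (n : ℕ) : Q n ⟶ Q (n + 1) := ObjectProperty.homMk (cokernel.desc _ _ (hdesc n))
  have hr (n : ℕ) : q n ≫ r n = q (n + 1) := by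
    ext : 1
    exact cokernel.π_desc _ _ (hdesc n)
  -- Only the universal property of kernels in `rep` is needed: `j n` factors through the kernel of
  -- `q (n + 1)` but not through that of `q n`.
  refine not_strictMono_of_wellFoundedGT (fun n => kernelSubobject (q n))
    (strictMono_nat_of_lt_succ fun n => lt_of_le_not_ge ?_ fun h => ?_)
  · refine le_kernelSubobject _ _ ?_
    rw [← hr, ← Category.assoc, kernelSubobject_arrow_comp, zero_comp]
  · have h1 : (kernelSubobject (q (n + 1))).Factors (j n) := by
      rw [kernelSubobject_factors_iff, fpRep_hom_eq_zero_iff]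
      exact comp_cokernelπ_eq_zero hy n.lt_succ_self
    have h2 := Subobject.factors_of_le _ h h1
    rw [kernelSubobject_factors_iff, fpRep_hom_eq_zero_iff] at h2
    exact comp_cokernelπ_ne_zero hy n (hlt n) h2

end Representable

end PosetRep

end

theorem mainTheorem4 (P : Type u) [PartialOrder P] (F : Type v) [Field F] :
    ((∃ _ : Abelian (PosetRep.FpRep P F),
        ∀ X : PosetRep.FpRep P F, PosetRep.HasFiniteLength X) ↔
      ∀ x : P, (Set.Iic x).Finite) ∧
    ((Nonempty (Abelian (PosetRep.FpRep P F)) ∧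
        ∀ X : PosetRep.FpRep P F, IsNoetherianObject X) ↔
      ∀ (x : P) (I : ℕ →o LowerSet (Set.Iic x)), ∃ n : ℕ, ∀ m : ℕ, n ≤ m → I m = I n) := by
  refine ⟨⟨fun ⟨_, h⟩ x => (h (PosetRep.fpRepresentable F x)).finite_Iic, fun h => ?_⟩,
    fun ⟨⟨A⟩, h⟩ x I => ?_, fun h => ?_⟩
  -- A finite `↓x` has finitely many ideals, which gives both chain conditions.
  · have hfin (x : P) : Finite (LowerSet (Set.Iic x)) :=
      have := (h x).to_subtype
      Finite.of_injective _ SetLike.coe_injective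
    have hN (x : P) := PosetRep.isNoetherianObject_representable (F := F) x
    have hA (x : P) := PosetRep.isArtinianObject_representable (F := F) x
    let _ := PosetRep.abelianFpRep hN
    exact ⟨PosetRep.abelianFpRep hN, fun X =>
      PosetRep.hasFiniteLength_of_isNoetherianObject_of_isArtinianObject
        (PosetRep.isNoetherianObject_fpRep hN X) (PosetRep.isArtinianObject_fpRep hN hA X)⟩
  · have := PosetRep.wellFoundedGT_lowerSet_of_isNoetherianObject A x
      ((isNoetherianObject.is_iff _).1 (h (PosetRep.fpRepresentable F x)))
    obtain ⟨n, hn⟩ := wellFoundedGT_iff_monotone_chain_condition.1 this I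
    exact ⟨n, fun m hm => (hn m hm).symm⟩
  · have hN (x : P) : isNoetherianObject (PosetRep.representable F x) := by
      have : WellFoundedGT (LowerSet (Set.Iic x)) :=
        wellFoundedGT_iff_monotone_chain_condition.2 fun I =>
          (h x I).imp fun n hn m hm => (hn m hm).symm
      exact PosetRep.isNoetherianObject_representable x
    exact ⟨⟨PosetRep.abelianFpRep hN⟩, fun X =>
      (isNoetherianObject.is_iff _).2 (PosetRep.isNoetherianObject_fpRep hN X)⟩
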